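/- Let $M$ be a smooth manifold of dimension $2n\ge 4$ with a smooth almost complex structure $J$ ($J^2=-\mathrm{id}$) and a smooth pseudo-Riemannian metric $g$ which is a Norden metric, i.e. $g(JX,JY)=-g(X,Y)$ for all vector fields $X,Y$. Let $\nabla$ be the Levi-Civita connection of $g$, let $R(X,Y)Z=\nabla_X\nabla_YZ-\nabla_Y\nabla_XZ-\nabla_{[X,Y]}Z$ and $R(X,Y,Z,U)=g(R(X,Y)Z,U)$, and let $F(X,Y,Z)=g\big((\nabla_XJ)Y,Z\big)$. Assume that (a) $(M,J,g)$ is a $\mathcal W_3$-manifold (quasi-Kähler manifold with Norden metric), i.e. $F(x,y,z)+F(y,z,x)+F(z,x,y)=0$ for all $p\in M$ and all $x,y,z\in T_pM$; (b) $(M,J,g)$ has Kähler curvature tensor, i.e. $R(X,Y,JZ,JU)=-R(X,Y,Z,U)$ for all smooth vector fields $X,Y,Z,U$ on $M$. Then $(M,J,g)$ is isotropic Kähler: at every point $p\in M$ and for every basis $(e_i)$ of $T_pM$, with $(g^{ij})$ the inverse of the matrix $\big(g(e_i,e_j)\big)$, the square norm of $\nabla J$ vanishes: $$\|\nabla J\|=\sum_{i,j,k,l}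 g^{ij}g^{kl}\,g\big((\nabla_{e_i}J)e_k,(\nabla_{e_j}J)e_l\big)=0 .$$ -/

import Mathlib

open Bundle
open scoped Manifold ContDiff Topology

noncomputable section

namespace NordenGeometry

section PseudoRiemannian

variable {E : Type*} [NormedAddCommGroup E] [NormedSpace ℝ E]
  {M : Type*} [TopologicalSpace M] [ChartedSpace E M]

/-- A vector field on `M` of class `C^∞`. -/
def IsSmoothField [IsManifold 𝓘(ℝ, E) ∞ M] (X : ∀ x : M, TangentSpace 𝓘(ℝ, E) x) : Prop :=
  ContMDiff 𝓘(ℝ, E) (𝓘(ℝ, E).prod 𝓘(ℝ, E)) ∞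
    (fun x ↦ TotalSpace.mk' E (E := fun y : M ↦ TangentSpace 𝓘(ℝ, E) y) x (X x))

variable (E M) in
/-- A smooth pseudo-Riemannian metric (nondegenerate, of arbitrary signature) on `M`. -/
structure PseudoMetric [IsManifold 𝓘(ℝ, E) ∞ M] where
  /-- The scalar product of each tangent space. -/
  val (x : M) : TangentSpace 𝓘(ℝ, E) x →L[ℝ] TangentSpace 𝓘(ℝ, E) x →L[ℝ] ℝ
  symm (x : M) (v w : TangentSpace 𝓘(ℝ, E) x) : val x v w = val x w v
  nondegenerate (x : M) (v : TangentSpace 𝓘(ℝ, E) x) (hv : ∀ w, val x v w = 0) : v = 0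
  contMDiff : ContMDiff 𝓘(ℝ, E) (𝓘(ℝ, E).prod 𝓘(ℝ, E →L[ℝ] E →L[ℝ] ℝ)) ∞
    (fun x ↦ TotalSpace.mk' (E →L[ℝ] E →L[ℝ] ℝ)
      (E := fun y : M ↦ TangentSpace 𝓘(ℝ, E) y →L[ℝ] TangentSpace 𝓘(ℝ, E) y →L[ℝ] ℝ) x (val x))

variable (E M) in
/-- A smooth almost complex structure on `M`. -/
structure AlmostComplexStructure [IsManifold 𝓘(ℝ, E) ∞ M] where
  /-- The endomorphism of each tangent space. -/
  val (x : M) : TangentSpace 𝓘(ℝ, E) x →L[ℝ] TangentSpace 𝓘(ℝ, E) x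
  sq (x : M) (v : TangentSpace 𝓘(ℝ, E) x) : val x (val x v) = -v
  contMDiff : ContMDiff 𝓘(ℝ, E) (𝓘(ℝ, E).prod 𝓘(ℝ, E →L[ℝ] E)) ∞
    (fun x ↦ TotalSpace.mk' (E →L[ℝ] E)
      (E := fun y : M ↦ TangentSpace 𝓘(ℝ, E) y →L[ℝ] TangentSpace 𝓘(ℝ, E) y) x (val x))

variable [IsManifold 𝓘(ℝ, E) ∞ M]

/-- The vector field `J X`. -/
def AlmostComplexStructure.app (J : AlmostComplexStructure E M)
    (X : ∀ x : M, TangentSpace 𝓘(ℝ, E) x) : ∀ x : M, TangentSpace 𝓘(ℝ, E) x :=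
  fun x ↦ J.val x (X x)

/-- The function `g(X, Y)`. -/
def PseudoMetric.app (g : PseudoMetric E M) (X Y : ∀ x : M, TangentSpace 𝓘(ℝ, E) x) : M → ℝ :=
  fun x ↦ g.val x (X x) (Y x)

lemma AlmostComplexStructure.mdifferentiableAt_app (J : AlmostComplexStructure E M)
    {X : ∀ x : M, TangentSpace 𝓘(ℝ, E) x} {x : M} (hX : MDiffAt (T% X) x) :
    MDiffAt (T% (J.app X)) x :=
  MDifferentiableAt.clm_bundle_apply (J.contMDiff.mdifferentiable (by simp) x) hX

lemma PseudoMetric.mdifferentiableAt_app (g : PseudoMetric E M)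
    {X Y : ∀ x : M, TangentSpace 𝓘(ℝ, E) x} {x : M} (hX : MDiffAt (T% X) x)
    (hY : MDiffAt (T% Y) x) : MDiffAt (g.app X Y) x := by
  have : MDifferentiableAt 𝓘(ℝ, E) (𝓘(ℝ, E).prod 𝓘(ℝ))
      (fun m ↦ TotalSpace.mk' ℝ (E := Bundle.Trivial M ℝ) m (g.val m (X m) (Y m))) x :=
    MDifferentiableAt.clm_bundle_apply₂ (F₁ := E) (F₂ := E)
      (g.contMDiff.mdifferentiable (by simp) x) hX hY
  simp only [mdifferentiableAt_totalSpace] at this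
  exact this.2

/-- The right-hand side of the Koszul formula for `2 g(∇_X Y, Z)`, at the point `x`. -/
def koszul (g : PseudoMetric E M) (X Y Z : ∀ x : M, TangentSpace 𝓘(ℝ, E) x) (x : M) : ℝ :=
  d% (g.app Y Z) x (X x) + d% (g.app Z X) x (Y x) - d% (g.app X Y) x (Z x)
    + g.val x (VectorField.mlieBracket 𝓘(ℝ, E) X Y x) (Z x)
    - g.val x (VectorField.mlieBracket 𝓘(ℝ, E) Y Z x) (X x)
    + g.val x (VectorField.mlieBracket 𝓘(ℝ, E) Z X x) (Y x)

lemma PseudoMetric.app_smul_left (g : PseudoMetric E M) (f : M → ℝ)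
    (X Y : ∀ x : M, TangentSpace 𝓘(ℝ, E) x) : g.app (f • X) Y = f * g.app X Y := by
  ext x; simp [PseudoMetric.app]

lemma PseudoMetric.app_smul_right (g : PseudoMetric E M) (f : M → ℝ)
    (X Y : ∀ x : M, TangentSpace 𝓘(ℝ, E) x) : g.app X (f • Y) = f * g.app X Y := by
  ext x; simp [PseudoMetric.app]

lemma PseudoMetric.app_add_left (g : PseudoMetric E M)
    (X X' Y : ∀ x : M, TangentSpace 𝓘(ℝ, E) x) : g.app (X + X') Y = g.app X Y + g.app X' Y := by
  ext x; simp [PseudoMetric.app]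

lemma PseudoMetric.app_add_right (g : PseudoMetric E M)
    (X Y Y' : ∀ x : M, TangentSpace 𝓘(ℝ, E) x) : g.app X (Y + Y') = g.app X Y + g.app X Y' := by
  ext x; simp [PseudoMetric.app]

lemma PseudoMetric.app_comm (g : PseudoMetric E M)
    (X Y : ∀ x : M, TangentSpace 𝓘(ℝ, E) x) : g.app X Y = g.app Y X := by
  ext x; exact g.symm x _ _

variable [FiniteDimensional ℝ E]

lemma koszul_tensorial_left (g : PseudoMetric E M) {x : M}
    {Y Z : ∀ x : M, TangentSpace 𝓘(ℝ, E) x} (hY : MDiffAt (T% Y) x) (hZ : MDiffAt (T% Z) x) :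
    TensorialAt 𝓘(ℝ, E) E (fun X ↦ koszul g X Y Z x) x where
  smul {f X} hf hX := by
    have h1 := g.mdifferentiableAt_app hZ hX
    have h2 := g.mdifferentiableAt_app hX hY
    simp only [koszul, g.app_smul_left, g.app_smul_right]
    rw [mvfderiv_mul hf h1, mvfderiv_mul hf h2, VectorField.mlieBracket_smul_left hf hX,
      VectorField.mlieBracket_smul_right hf hX]
    simp [PseudoMetric.app, g.symm x (X x)]
    ring
  add {X X'} hX hX' := by
    simp only [koszul, g.app_add_left, g.app_add_right]
    rw [mvfderiv_add (g.mdifferentiableAt_app hZ hX) (g.mdifferentiableAt_app hZ hX'),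
      mvfderiv_add (g.mdifferentiableAt_app hX hY) (g.mdifferentiableAt_app hX' hY),
      VectorField.mlieBracket_add_left hX hX', VectorField.mlieBracket_add_right hX hX']
    simp
    ring

lemma koszul_tensorial_right (g : PseudoMetric E M) {x : M}
    {X Y : ∀ x : M, TangentSpace 𝓘(ℝ, E) x} (hX : MDiffAt (T% X) x) (hY : MDiffAt (T% Y) x) :
    TensorialAt 𝓘(ℝ, E) E (fun Z ↦ koszul g X Y Z x) x where
  smul {f Z} hf hZ := by
    have h1 := g.mdifferentiableAt_app hY hZ
    have h2 := g.mdifferentiableAt_app hZ hX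
    simp only [koszul, g.app_smul_left, g.app_smul_right]
    rw [mvfderiv_mul hf h1, mvfderiv_mul hf h2, VectorField.mlieBracket_smul_left hf hZ,
      VectorField.mlieBracket_smul_right hf hZ]
    simp [PseudoMetric.app, g.symm x (Z x)]
    ring
  add {Z Z'} hZ hZ' := by
    simp only [koszul, g.app_add_left, g.app_add_right]
    rw [mvfderiv_add (g.mdifferentiableAt_app hY hZ) (g.mdifferentiableAt_app hY hZ'),
      mvfderiv_add (g.mdifferentiableAt_app hZ hX) (g.mdifferentiableAt_app hZ' hX),
      VectorField.mlieBracket_add_left hZ hZ', VectorField.mlieBracket_add_right hZ hZ']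
    simp
    ring

/-- The bilinear form `(X, Z) ↦ 2 g(∇_X Y, Z)` on `T_x M`, for `Y` differentiable at `x`. -/
def koszulForm (g : PseudoMetric E M) (Y : ∀ x : M, TangentSpace 𝓘(ℝ, E) x) (x : M)
    (hY : MDiffAt (T% Y) x) :
    TangentSpace 𝓘(ℝ, E) x →L[ℝ] TangentSpace 𝓘(ℝ, E) x →L[ℝ] ℝ :=
  TensorialAt.mkHom₂ (fun X Z ↦ koszul g X Y Z x) x
    (fun _ hZ ↦ koszul_tensorial_left g hY hZ) (fun _ hX ↦ koszul_tensorial_right g hX hY)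

lemma koszulForm_apply (g : PseudoMetric E M) {X Y Z : ∀ x : M, TangentSpace 𝓘(ℝ, E) x} {x : M}
    (hX : MDiffAt (T% X) x) (hY : MDiffAt (T% Y) x) (hZ : MDiffAt (T% Z) x) :
    koszulForm g Y x hY (X x) (Z x) = koszul g X Y Z x :=
  TensorialAt.mkHom₂_apply _ _ hX hZ

instance instT2SpaceTangent (x : M) : T2Space (TangentSpace 𝓘(ℝ, E) x) :=
  inferInstanceAs (T2Space E)

instance instFiniteDimensionalTangent (x : M) : FiniteDimensional ℝ (TangentSpace 𝓘(ℝ, E) x) :=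
  inferInstanceAs (FiniteDimensional ℝ E)

/-- The isomorphism `v ↦ g(v, ·)` from `T_x M` onto its dual. -/
def PseudoMetric.flat (g : PseudoMetric E M) (x : M) :
    TangentSpace 𝓘(ℝ, E) x ≃L[ℝ] (TangentSpace 𝓘(ℝ, E) x →L[ℝ] ℝ) :=
  (LinearEquiv.ofInjectiveOfFinrankEq (g.val x).toLinearMap
    ((injective_iff_map_eq_zero _).2 fun v hv ↦ g.nondegenerate x v fun w ↦
      congrArg (fun l : TangentSpace 𝓘(ℝ, E) x →L[ℝ] ℝ ↦ l w) hv)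
    (by
      rw [← LinearEquiv.finrank_eq (LinearMap.toContinuousLinearMap
        (𝕜 := ℝ) (E := TangentSpace 𝓘(ℝ, E) x) (F' := ℝ))]
      exact (Subspace.dual_finrank_eq (K := ℝ)).symm)).toContinuousLinearEquiv

lemma PseudoMetric.flat_apply (g : PseudoMetric E M) (x : M) (v w : TangentSpace 𝓘(ℝ, E) x) :
    g.flat x v w = g.val x v w := rfl

lemma PseudoMetric.ext_of_val (g : PseudoMetric E M) {x : M} {v w : TangentSpace 𝓘(ℝ, E) x}
    (h : ∀ z, g.val x v z = g.val x w z) : v = w :=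
  (g.flat x).injective (ContinuousLinearMap.ext h)

open Classical in
/-- The Levi-Civita derivative `v ↦ ∇_v Y` at `x`, given by the Koszul formula
(and set to zero where `Y` is not differentiable). -/
def leviCivitaFun (g : PseudoMetric E M) (Y : ∀ x : M, TangentSpace 𝓘(ℝ, E) x) (x : M) :
    TangentSpace 𝓘(ℝ, E) x →L[ℝ] TangentSpace 𝓘(ℝ, E) x :=
  if hY : MDiffAt (T% Y) x then
    (2⁻¹ : ℝ) • ((g.flat x).symm : _ →L[ℝ] TangentSpace 𝓘(ℝ, E) x).comp (koszulForm g Y x hY)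
  else 0

lemma val_leviCivitaFun (g : PseudoMetric E M) {X Y Z : ∀ x : M, TangentSpace 𝓘(ℝ, E) x} {x : M}
    (hX : MDiffAt (T% X) x) (hY : MDiffAt (T% Y) x) (hZ : MDiffAt (T% Z) x) :
    g.val x (leviCivitaFun g Y x (X x)) (Z x) = 2⁻¹ * koszul g X Y Z x := by
  rw [← koszulForm_apply g hX hY hZ, ← g.flat_apply]
  simp [leviCivitaFun, hY]

/-- To identify two endomorphisms of `T_x M` it suffices to test them on differentiable fields. -/
lemma endo_ext (g : PseudoMetric E M) {x : M}
    {A B : TangentSpace 𝓘(ℝ, E) x →L[ℝ] TangentSpace 𝓘(ℝ, E) x}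
    (h : ∀ X Z : ∀ x : M, TangentSpace 𝓘(ℝ, E) x, MDiffAt (T% X) x → MDiffAt (T% Z) x →
      g.val x (A (X x)) (Z x) = g.val x (B (X x)) (Z x)) : A = B := by
  ext v
  refine g.ext_of_val fun z ↦ ?_
  simpa using h (FiberBundle.extend E v) (FiberBundle.extend E z)
    (FiberBundle.mdifferentiableAt_extend ..) (FiberBundle.mdifferentiableAt_extend ..)

/-- The Levi-Civita connection of a pseudo-Riemannian metric. -/
def leviCivita (g : PseudoMetric E M) :
    CovariantDerivative 𝓘(ℝ, E) E (fun x : M ↦ TangentSpace 𝓘(ℝ, E) x) where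
  toFun := leviCivitaFun g
  isCovariantDerivativeOnUniv :=
    { add := by
        intro Y Y' x hY hY' _
        refine endo_ext g fun X Z hX hZ ↦ ?_
        have hYY : MDiffAt (T% (Y + Y')) x := mdifferentiableAt_add_section hY hY'
        rw [val_leviCivitaFun g hX hYY hZ, add_apply, map_add,
          add_apply, val_leviCivitaFun g hX hY hZ,
          val_leviCivitaFun g hX hY' hZ]
        simp only [koszul, g.app_add_left, g.app_add_right]
        rw [mvfderiv_add (g.mdifferentiableAt_app hY hZ) (g.mdifferentiableAt_app hY' hZ),
          mvfderiv_add (g.mdifferentiableAt_app hX hY) (g.mdifferentiableAt_app hX hY'),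
          VectorField.mlieBracket_add_left hY hY', VectorField.mlieBracket_add_right hY hY']
        simp
        ring
      leibniz := by
        intro Y f x hY hf _
        refine endo_ext g fun X Z hX hZ ↦ ?_
        have hfY : MDiffAt (T% (f • Y)) x := hf.smul_section hY
        rw [val_leviCivitaFun g hX hfY hZ, add_apply, map_add,
          add_apply, smul_apply, map_smul,
          smul_apply, val_leviCivitaFun g hX hY hZ]
        simp only [koszul, g.app_smul_left, g.app_smul_right]
        rw [mvfderiv_mul hf (g.mdifferentiableAt_app hY hZ),
          mvfderiv_mul hf (g.mdifferentiableAt_app hX hY),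
          VectorField.mlieBracket_smul_left hf hY, VectorField.mlieBracket_smul_right hf hY]
        simp [PseudoMetric.app, g.symm x (Y x)]
        ring }

/-- The Levi-Civita connection is torsion-free: `∇_X Y - ∇_Y X = [X, Y]`. -/
theorem leviCivita_torsion (g : PseudoMetric E M) : (leviCivita g).torsion = 0 := by
  rw [CovariantDerivative.torsion_eq_zero_iff]
  intro X Y x hX hY
  refine g.ext_of_val fun z ↦ ?_
  obtain ⟨Z, hZ, rfl⟩ : ∃ Z : ∀ x : M, TangentSpace 𝓘(ℝ, E) x, MDiffAt (T% Z) x ∧ Z x = z :=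
    ⟨FiberBundle.extend E z, FiberBundle.mdifferentiableAt_extend .., by simp⟩
  have h1 := val_leviCivitaFun g hX hY hZ
  have h2 := val_leviCivitaFun g hY hX hZ
  rw [map_sub, sub_apply]
  change g.val x (leviCivitaFun g Y x (X x)) (Z x) - g.val x (leviCivitaFun g X x (Y x)) (Z x) = _
  rw [h1, h2]
  simp only [koszul]
  rw [g.app_comm Z X, g.app_comm Y Z, g.app_comm Y X,
    VectorField.mlieBracket_swap_apply (V := Y) (W := X),
    VectorField.mlieBracket_swap_apply (V := X) (W := Z),
    VectorField.mlieBracket_swap_apply (V := Z) (W := Y)]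
  simp
  ring

/-- The Levi-Civita connection is metric: `X g(Y, Z) = g(∇_X Y, Z) + g(Y, ∇_X Z)`. -/
theorem leviCivita_metric (g : PseudoMetric E M) {X Y Z : ∀ x : M, TangentSpace 𝓘(ℝ, E) x} {x : M}
    (hX : MDiffAt (T% X) x) (hY : MDiffAt (T% Y) x) (hZ : MDiffAt (T% Z) x) :
    d% (g.app Y Z) x (X x) =
      g.val x (leviCivita g Y x (X x)) (Z x) + g.val x (Y x) (leviCivita g Z x (X x)) := by
  have h1 := val_leviCivitaFun g hX hY hZ
  have h2 := val_leviCivitaFun g hX hZ hY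
  rw [g.symm x (Y x)]
  change _ = g.val x (leviCivitaFun g Y x (X x)) (Z x) + g.val x (leviCivitaFun g Z x (X x)) (Y x)
  rw [h1, h2]
  simp only [koszul]
  rw [g.app_comm Z X, g.app_comm Y X, g.app_comm Z Y,
    VectorField.mlieBracket_swap_apply (V := Y) (W := X),
    VectorField.mlieBracket_swap_apply (V := X) (W := Z),
    VectorField.mlieBracket_swap_apply (V := Z) (W := Y)]
  simp
  ring

/-- The curvature `R(X, Y) Z = ∇_X ∇_Y Z - ∇_Y ∇_X Z - ∇_[X,Y] Z` of the Levi-Civita connection. -/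
def curvature (g : PseudoMetric E M) (X Y Z : ∀ x : M, TangentSpace 𝓘(ℝ, E) x) :
    ∀ x : M, TangentSpace 𝓘(ℝ, E) x :=
  fun x ↦ leviCivita g (fun y ↦ leviCivita g Z y (Y y)) x (X x)
    - leviCivita g (fun y ↦ leviCivita g Z y (X y)) x (Y x)
    - leviCivita g Z x (VectorField.mlieBracket 𝓘(ℝ, E) X Y x)

/-- The curvature tensor of type `(0,4)`: `R(X, Y, Z, U) = g(R(X, Y) Z, U)`. -/
def curvature₄ (g : PseudoMetric E M) (X Y Z U : ∀ x : M, TangentSpace 𝓘(ℝ, E) x) (x : M) : ℝ :=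
  g.val x (curvature g X Y Z x) (U x)

/-- The operation `Y ↦ (∇ J) Y = ∇ (J Y) - J ∇ Y` depends only on the value of `Y` at `x`. -/
lemma nablaJ_tensorial (g : PseudoMetric E M) (J : AlmostComplexStructure E M) (x : M) :
    TensorialAt 𝓘(ℝ, E) E
      (fun Y ↦ leviCivita g (J.app Y) x - (J.val x).comp (leviCivita g Y x)) x where
  smul {f Y} hf hY := by
    have e : J.app (f • Y) = f • J.app Y := by
      ext y; simp [AlmostComplexStructure.app]
    rw [e, (leviCivita g).isCovariantDerivativeOnUniv.leibniz (J.mdifferentiableAt_app hY) hf,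
      (leviCivita g).isCovariantDerivativeOnUniv.leibniz hY hf]
    ext v
    simp [AlmostComplexStructure.app, smul_sub]
  add {Y Y'} hY hY' := by
    have e : J.app (Y + Y') = J.app Y + J.app Y' := by
      ext y; simp [AlmostComplexStructure.app]
    rw [e, (leviCivita g).isCovariantDerivativeOnUniv.add (J.mdifferentiableAt_app hY)
      (J.mdifferentiableAt_app hY'), (leviCivita g).isCovariantDerivativeOnUniv.add hY hY']
    ext v
    simp
    abel

/-- The tangent vector `(∇_u J) v = ∇_u (J V) - J ∇_u V` at `x`, for any field `V` that is
differentiable at `x` with `V x = v`. -/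
def nablaJ (g : PseudoMetric E M) (J : AlmostComplexStructure E M) (x : M)
    (u v : TangentSpace 𝓘(ℝ, E) x) : TangentSpace 𝓘(ℝ, E) x :=
  TensorialAt.mkHom _ x (nablaJ_tensorial g J x) v u

lemma nablaJ_apply (g : PseudoMetric E M) (J : AlmostComplexStructure E M) {x : M}
    (u : TangentSpace 𝓘(ℝ, E) x) {V : ∀ x : M, TangentSpace 𝓘(ℝ, E) x} (hV : MDiffAt (T% V) x) :
    nablaJ g J x u (V x) = leviCivita g (J.app V) x u - J.val x (leviCivita g V x u) := by
  rw [nablaJ, TensorialAt.mkHom_apply _ hV]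
  rfl

/-- The tensor `F(u, v, w) = g((∇_u J) v, w)`. -/
def tensorF (g : PseudoMetric E M) (J : AlmostComplexStructure E M) (x : M)
    (u v w : TangentSpace 𝓘(ℝ, E) x) : ℝ :=
  g.val x (nablaJ g J x u v) w

/-- `g` is a Norden metric with respect to `J`: `g(J v, J w) = -g(v, w)`. -/
def IsNorden (g : PseudoMetric E M) (J : AlmostComplexStructure E M) : Prop :=
  ∀ (x : M) (v w : TangentSpace 𝓘(ℝ, E) x), g.val x (J.val x v) (J.val x w) = -g.val x v w

/-- `(M, J, g)` is in the class `W₃`: it is an almost complex manifold with Norden metric on which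
the cyclic sum of `F` vanishes. -/
def IsW₃ (g : PseudoMetric E M) (J : AlmostComplexStructure E M) : Prop :=
  IsNorden g J ∧ ∀ (x : M) (u v w : TangentSpace 𝓘(ℝ, E) x),
    tensorF g J x u v w + tensorF g J x v w u + tensorF g J x w u v = 0

/-- The curvature is of Kähler type: `R(X, Y, J Z, J U) = -R(X, Y, Z, U)` for all smooth fields. -/
def HasKahlerCurvature (g : PseudoMetric E M) (J : AlmostComplexStructure E M) : Prop :=
  ∀ X Y Z U : ∀ x : M, TangentSpace 𝓘(ℝ, E) x,
    IsSmoothField X → IsSmoothField Y → IsSmoothField Z → IsSmoothField U →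
    ∀ x, curvature₄ g X Y (J.app Z) (J.app U) x = -curvature₄ g X Y Z U x

/-- The matrix `g^{ij}`, inverse to the Gram matrix `g(e_i, e_j)` of a basis of `T_x M`. -/
def invGram (g : PseudoMetric E M) (x : M) {ι : Type*} [Fintype ι] [DecidableEq ι]
    (e : Module.Basis ι ℝ (TangentSpace 𝓘(ℝ, E) x)) : Matrix ι ι ℝ :=
  (Matrix.of fun i j ↦ g.val x (e i) (e j))⁻¹

/-- The square norm `‖∇J‖ = g^{ij} g^{kl} g((∇_{e_i} J) e_k, (∇_{e_j} J) e_l)` at `x`, computed in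
the basis `e` of `T_x M`. -/
def sqNormNablaJ (g : PseudoMetric E M) (J : AlmostComplexStructure E M) (x : M)
    {ι : Type*} [Fintype ι] [DecidableEq ι]
    (e : Module.Basis ι ℝ (TangentSpace 𝓘(ℝ, E) x)) : ℝ :=
  ∑ i, ∑ j, ∑ k, ∑ l, invGram g x e i j * invGram g x e k l *
    g.val x (nablaJ g J x (e i) (e k)) (nablaJ g J x (e j) (e l))

/-- `(M, J, g)` is isotropic Kähler: the square norm of `∇J` vanishes at every point, in every basis
of the tangent space. -/
def IsIsotropicKahler (g : PseudoMetric E M) (J : AlmostComplexStructure E M) : Prop :=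
  ∀ (x : M) (e : Module.Basis (Fin (Module.finrank ℝ E)) ℝ (TangentSpace 𝓘(ℝ, E) x)),
    sqNormNablaJ g J x e = 0

end PseudoRiemannian

end NordenGeometry

end

/-! Write `A_X = ∇_X J` and `b(X,Y) = ∇²_{X,Y} J`, and set `t(X,Y,Z,U) = g(b(X,Y)Z, U)`. By the
Ricci identity, the skew part of `b` is the commutator `[R(X,Y), J]`, which vanishes for Kähler
curvature; so `t` is symmetric in `X, Y`. Differentiating the Norden and `W₃` conditions makes `t`
symmetric in `Z, U`, with zero cyclic sum over `Y, Z, U`. As for a Riemann tensor, these symmetries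
force `t(X,Y,Z,U) = t(Z,U,X,Y)` (`pair_symm_of_cyclic`).

Differentiating `J² = -1` twice gives `bJ + Jb = -(A_X A_Y + A_Y A_X)`. Its trace is `tr(J b) =
-tr(A_X A_Y)`; its trace after multiplication by `J` is `tr b = 0`, since `A` anticommutes with `J`.
As each `A_X` is self-adjoint, `‖∇J‖ = g^{ij} tr(A_i A_j) = -g^{ij} g^{kl} t(e_i, e_j, e_k, J e_l)`.
Pair symmetry turns this into `-g^{kl} tr b(e_k, J e_l) = 0`.

The algebra is `sum_inv_gram_mul_inv_gram_eq_zero`; its geometric inputs are `hessJ_app`,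
`HasKahlerCurvature.hessJ_comm`, `IsNorden.val_hessJ_symm` and `IsW₃.val_hessJ_cyclic`. The second
derivative makes sense because `∇_X Y` is differentiable for smooth `X, Y`
(`mdifferentiableAt_leviCivita`). -/

noncomputable section

namespace NordenGeometry

/-! ### Traces, Gram matrices and the algebraic core at one point. -/

section LinearAlgebra

variable {V ι : Type*} [AddCommGroup V] [Module ℝ V] [Fintype ι] [DecidableEq ι]

/-- The Gram matrix of a bilinear form in a basis. -/
abbrev gram (B : LinearMap.BilinForm ℝ V) (e : Module.Basis ι ℝ V) : Matrix ι ι ℝ :=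
  Matrix.of fun i j ↦ B (e i) (e j)

lemma isUnit_det_gram {B : LinearMap.BilinForm ℝ V} (hs : ∀ v w, B v w = B w v)
    (hB : ∀ v, (∀ w, B v w = 0) → v = 0) (e : Module.Basis ι ℝ V) :
    IsUnit (gram B e).det := by
  have hG : gram B e = LinearMap.BilinForm.toMatrix e B := by
    ext i j; simp [LinearMap.BilinForm.toMatrix_apply]
  rw [hG, isUnit_iff_ne_zero, ← LinearMap.BilinForm.nondegenerate_iff_det_ne_zero]
  exact ⟨hB, fun v hv ↦ hB v fun w ↦ by rw [hs]; exact hv w⟩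

/-- Contracting `(v, w) ↦ B (C v) w` with the inverse Gram matrix gives the trace of `C`. -/
lemma sum_inv_gram_eq_trace {B : LinearMap.BilinForm ℝ V} (hs : ∀ v w, B v w = B w v)
    {e : Module.Basis ι ℝ V} (hG : IsUnit (gram B e).det) (C : Module.End ℝ V) :
    ∑ k, ∑ l, (gram B e)⁻¹ k l * B (C (e k)) (e l) = LinearMap.trace ℝ V C := by
  rw [LinearMap.trace_eq_matrix_trace ℝ e, Matrix.trace]
  refine Finset.sum_congr rfl fun k _ ↦ ?_
  have h (l : ι) : B (C (e k)) (e l)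
      = ∑ m, (gram B e) l m * LinearMap.toMatrix e e C m k := by
    conv_lhs => rw [← e.sum_repr (C (e k))]
    simp [LinearMap.toMatrix_apply, hs (e l), mul_comm, -Module.Basis.sum_repr]
  calc _ = ((gram B e)⁻¹ * (gram B e * LinearMap.toMatrix e e C)) k k := by
        simp only [h, Matrix.mul_apply]
    _ = _ := by rw [← Matrix.mul_assoc, Matrix.nonsing_inv_mul _ hG, Matrix.one_mul]; rfl

/-- A `4`-tensor that is symmetric in its first two and in its last two arguments and has vanishing
cyclic sum over the last three arguments is symmetric under exchange of the two pairs. -/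
lemma pair_symm_of_cyclic {κ : Type*} {t : κ → κ → κ → κ → ℝ} (h₁ : ∀ i j k l, t i j k l = t j i k l)
    (h₂ : ∀ i j k l, t i j k l = t i j l k)
    (h₃ : ∀ i j k l, t i j k l + t i k l j + t i l j k = 0) (i j k l : κ) :
    t i j k l = t k l i j := by
  -- If `C_a` is the cyclic identity with first index `a`, then up to `h₁` and `h₂` the combination
  -- `C_i + C_j - C_k - C_l` is `2 t i j k l - 2 t k l i j`.
  linarith [h₃ i j k l, h₃ j i k l, h₃ k i j l, h₃ l i j k, h₁ i j k l, h₁ i k l j, h₁ i l j k,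
    h₁ j k l i, h₁ j l i k, h₁ k l i j, h₁ k i j l, h₁ k j l i, h₁ l i j k, h₁ l j k i, h₁ l k i j,
    h₂ i j k l, h₂ i k l j, h₂ i l j k, h₂ j k l i, h₂ j l i k, h₂ k l i j, h₂ j i k l,
    h₂ k i j l, h₂ k j l i, h₂ l i j k, h₂ l j k i, h₂ l k i j]

/-- Multiply `hb` by `J` and take the trace: the left side becomes `-2 tr b`. On the right,
cyclicity gives `tr(J A' A) = tr(A J A') = -tr(J A A')`, so the two products cancel; only `A` has to
anticommute with `J`. -/
lemma trace_eq_zero_of_anticomm {J A A' b : Module.End ℝ V} (hJ : J * J = -1)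
    (hA : A * J = -(J * A)) (hb : b * J + J * b = -(A * A' + A' * A)) :
    LinearMap.trace ℝ V b = 0 := by
  have h1 := congrArg (fun x ↦ LinearMap.trace ℝ V (J * x)) hb
  have h2 : LinearMap.trace ℝ V (J * (b * J)) = -LinearMap.trace ℝ V b := by
    rw [LinearMap.trace_mul_comm, mul_assoc, hJ]; simp
  have h3 : LinearMap.trace ℝ V (J * (J * b)) = -LinearMap.trace ℝ V b := by
    rw [← mul_assoc, hJ]; simp
  have h4 : LinearMap.trace ℝ V (J * (A' * A)) = -LinearMap.trace ℝ V (J * (A * A')) := by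
    rw [← mul_assoc, LinearMap.trace_mul_comm, ← mul_assoc, hA]; simp [mul_assoc]
  simp only [mul_add, mul_neg, map_add, map_neg, h2, h3, h4] at h1
  linarith

/-- The algebraic core: a family `b i j` of symmetric endomorphisms with the symmetries of the
second covariant derivative of `J` forces the square norm of `A = ∇J` to vanish. -/
lemma sum_inv_gram_mul_inv_gram_eq_zero {B : LinearMap.BilinForm ℝ V}
    (hs : ∀ v w, B v w = B w v) (hB : ∀ v, (∀ w, B v w = 0) → v = 0) (e : Module.Basis ι ℝ V)
    {J : Module.End ℝ V} {A : ι → Module.End ℝ V} {b : ι → ι → Module.End ℝ V}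
    (hJ : J * J = -1) (hJs : ∀ v w, B (J v) w = B v (J w))
    (hAs : ∀ i v w, B (A i v) w = B v (A i w)) (hAJ : ∀ i, A i * J = -(J * A i))
    (hb : ∀ i j, b i j * J + J * b i j = -(A i * A j + A j * A i))
    (hb₁ : ∀ i j k l, B (b i j (e k)) (e l) = B (b j i (e k)) (e l))
    (hb₂ : ∀ i j k l, B (b i j (e k)) (e l) = B (b i j (e l)) (e k))
    (hb₃ : ∀ i j k l, B (b i j (e k)) (e l) + B (b i k (e l)) (e j) + B (b i l (e j)) (e k) = 0) :
    ∑ i, ∑ j, ∑ k, ∑ l, (gram B e)⁻¹ i j * (gram B e)⁻¹ k l * B (A i (e k)) (A j (e l)) = 0 := by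
  have hG := isUnit_det_gram hs hB e
  have hpair := pair_symm_of_cyclic hb₁ hb₂ hb₃
  have htr (i j : ι) : LinearMap.trace ℝ V (b i j) = 0 :=
    trace_eq_zero_of_anticomm hJ (hAJ i) (hb i j)
  have hAA (i j : ι) : LinearMap.trace ℝ V (A j * A i) = -LinearMap.trace ℝ V (J * b i j) := by
    have h := congrArg (LinearMap.trace ℝ V) (hb i j)
    simp only [map_add, map_neg] at h
    rw [LinearMap.trace_mul_comm ℝ (b i j), LinearMap.trace_mul_comm ℝ (A i)] at h
    linarith
  -- The index pairs `(i, j)` and `(k, m)` are exchanged here, so that summing over `i, j`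
  -- afterwards contracts the endomorphism slots of `b k m`.
  have hsum (i j : ι) : ∑ k, ∑ l, (gram B e)⁻¹ i j * (gram B e)⁻¹ k l * B (A i (e k)) (A j (e l))
      = -∑ k, ∑ l, ∑ m, (gram B e)⁻¹ k l * LinearMap.toMatrix e e J m l *
          ((gram B e)⁻¹ i j * B (b k m (e i)) (e j)) := by
    have h1 : ∑ k, ∑ l, (gram B e)⁻¹ i j * (gram B e)⁻¹ k l * B (A i (e k)) (A j (e l))
        = (gram B e)⁻¹ i j * LinearMap.trace ℝ V (A j * A i) := by
      rw [← sum_inv_gram_eq_trace hs hG, Finset.mul_sum]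
      refine Finset.sum_congr rfl fun k _ ↦ ?_
      rw [Finset.mul_sum]
      refine Finset.sum_congr rfl fun l _ ↦ ?_
      rw [Module.End.mul_apply, hAs j, mul_assoc]
    rw [h1, hAA, ← sum_inv_gram_eq_trace hs hG, mul_neg, Finset.mul_sum]
    refine congrArg Neg.neg (Finset.sum_congr rfl fun k _ ↦ ?_)
    rw [Finset.mul_sum]
    refine Finset.sum_congr rfl fun l _ ↦ ?_
    have h2 : B ((J * b i j) (e k)) (e l)
        = ∑ m, LinearMap.toMatrix e e J m l * B (b k m (e i)) (e j) := by
      rw [Module.End.mul_apply, hJs, ← e.sum_repr (J (e l)), map_sum]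
      refine Finset.sum_congr rfl fun m _ ↦ ?_
      rw [map_smul, hpair i j k m, LinearMap.toMatrix_apply, smul_eq_mul]
    rw [h2, Finset.mul_sum, Finset.mul_sum]
    exact Finset.sum_congr rfl fun m _ ↦ by ring
  have hzero (k m : ι) : ∑ i, ∑ j, (gram B e)⁻¹ i j * B (b k m (e i)) (e j) = 0 := by
    rw [sum_inv_gram_eq_trace hs hG, htr]
  have hmove (f : ι → ι → ι → ℝ) : ∑ i, ∑ j, ∑ k, f i j k = ∑ k, ∑ i, ∑ j, f i j k :=
    (Finset.sum_congr rfl fun _ _ ↦ Finset.sum_comm).trans Finset.sum_comm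
  have hswap (f : ι → ι → ι → ι → ι → ℝ) : ∑ i, ∑ j, ∑ k, ∑ l, ∑ m, f i j k l m
      = ∑ k, ∑ l, ∑ m, ∑ i, ∑ j, f i j k l m := by
    rw [hmove]
    refine Finset.sum_congr rfl fun k _ ↦ ?_
    rw [hmove]
    exact Finset.sum_congr rfl fun l _ ↦ hmove _
  simp only [hsum, Finset.sum_neg_distrib]
  rw [hswap]
  simp only [← Finset.mul_sum, hzero, mul_zero, Finset.sum_const_zero, neg_zero]

end LinearAlgebra

/-! ### Smooth fields and the differentiability of their covariant derivatives. -/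

section SmoothFields

variable {E : Type*} [NormedAddCommGroup E] [NormedSpace ℝ E]
  {M : Type*} [TopologicalSpace M] [ChartedSpace E M] [IsManifold 𝓘(ℝ, E) ∞ M]

lemma IsSmoothField.mdifferentiableAt {X : ∀ x : M, TangentSpace 𝓘(ℝ, E) x} (hX : IsSmoothField X)
    (x : M) : MDiffAt (T% X) x :=
  ContMDiff.mdifferentiable hX (by simp) x

lemma IsSmoothField.app {X : ∀ x : M, TangentSpace 𝓘(ℝ, E) x} (hX : IsSmoothField X)
    (J : AlmostComplexStructure E M) : IsSmoothField (J.app X) :=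
  ContMDiff.clm_bundle_apply J.contMDiff hX

lemma IsSmoothField.contMDiff_app {X Y : ∀ x : M, TangentSpace 𝓘(ℝ, E) x} (hX : IsSmoothField X)
    (hY : IsSmoothField Y) (g : PseudoMetric E M) : ContMDiff 𝓘(ℝ, E) 𝓘(ℝ) ∞ (g.app X Y) := by
  have : ContMDiff 𝓘(ℝ, E) (𝓘(ℝ, E).prod 𝓘(ℝ)) ∞
      (fun m ↦ TotalSpace.mk' ℝ (E := Bundle.Trivial M ℝ) m (g.val m (X m) (Y m))) :=
    ContMDiff.clm_bundle_apply₂ (F₁ := E) (F₂ := E) g.contMDiff hX hY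
  intro x
  have h := this x
  simp only [contMDiffAt_totalSpace] at h
  exact h.2

/-- The derivative of a smooth function along a smooth field is differentiable. -/
lemma IsSmoothField.mdifferentiableAt_mvfderiv {X : ∀ x : M, TangentSpace 𝓘(ℝ, E) x}
    (hX : IsSmoothField X) {f : M → ℝ} (hf : ContMDiff 𝓘(ℝ, E) 𝓘(ℝ) ∞ f) (x : M) :
    MDiffAt (fun y ↦ d% f y (X y)) x := by
  -- The function `df(X)` is the fibre component of the tangent map of `f` composed with the section
  -- `X`.
  have h1 : ContMDiff 𝓘(ℝ, E).tangent 𝓘(ℝ).tangent 1 (tangentMap 𝓘(ℝ, E) 𝓘(ℝ) f) :=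
    hf.contMDiff_tangentMap (by norm_cast)
  have h2 := (h1.comp (hX.of_le (by norm_cast))) x
  have h3 := (contMDiffAt_totalSpace.1 h2).2
  have h4 := h3.mdifferentiableAt (by simp)
  refine h4.congr_of_eventuallyEq (.of_forall fun y ↦ ?_)
  simp [mvfderiv, tangentMap]
  rfl

variable [FiniteDimensional ℝ E]

lemma IsSmoothField.mdifferentiableAt_mlieBracket {X Y : ∀ x : M, TangentSpace 𝓘(ℝ, E) x}
    (hX : IsSmoothField X) (hY : IsSmoothField Y) (x : M) :
    MDiffAt (T% (VectorField.mlieBracket 𝓘(ℝ, E) X Y)) x := by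
  have := FiniteDimensional.complete ℝ E
  have : IsManifold 𝓘(ℝ, E) ((2 : ℕ∞) + 1) M := IsManifold.of_le (n := ∞) (by norm_cast)
  have : IsManifold 𝓘(ℝ, E) (minSmoothness ℝ 2) M := IsManifold.of_le (n := ∞) (by simp; norm_cast)
  exact (ContMDiffAt.mlieBracket_vectorField (m := 1) (n := 2)
    ((hX x).of_le (by norm_cast)) ((hY x).of_le (by norm_cast))
    (by simp; norm_cast)).mdifferentiableAt (by simp)

lemma mdifferentiableAt_koszul (g : PseudoMetric E M) {X Y Z : ∀ x : M, TangentSpace 𝓘(ℝ, E) x}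
    (hX : IsSmoothField X) (hY : IsSmoothField Y) (hZ : IsSmoothField Z) (x : M) :
    MDiffAt (koszul g X Y Z) x := by
  have h1 := hX.mdifferentiableAt_mvfderiv (hY.contMDiff_app hZ g) x
  have h2 := hY.mdifferentiableAt_mvfderiv (hZ.contMDiff_app hX g) x
  have h3 := hZ.mdifferentiableAt_mvfderiv (hX.contMDiff_app hY g) x
  have h4 := g.mdifferentiableAt_app (hX.mdifferentiableAt_mlieBracket hY x)
    (hZ.mdifferentiableAt x)
  have h5 := g.mdifferentiableAt_app (hY.mdifferentiableAt_mlieBracket hZ x)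
    (hX.mdifferentiableAt x)
  have h6 := g.mdifferentiableAt_app (hZ.mdifferentiableAt_mlieBracket hX x)
    (hY.mdifferentiableAt x)
  exact ((((h1.add h2).sub h3).add h4).sub h5).add h6

/-- A local smooth extension is cut off by a bump function equal to `1` at `x`. Global fields are
needed because the curvature hypothesis only concerns those. -/
lemma exists_isSmoothField [T2Space M] {x : M} (v : TangentSpace 𝓘(ℝ, E) x) :
    ∃ X : ∀ x : M, TangentSpace 𝓘(ℝ, E) x, IsSmoothField X ∧ X x = v := by
  obtain ⟨s, hs, hX⟩ := FiberBundle.exists_contMDiffOn_extend (k := ∞) 𝓘(ℝ, E) E v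
  obtain ⟨u, hus, hu, hxu⟩ := mem_nhds_iff.1 hs
  obtain ⟨f, -, hf⟩ := (SmoothBumpFunction.nhds_basis_tsupport (I := 𝓘(ℝ, E)) x).mem_iff.1
    (hu.mem_nhds hxu)
  refine ⟨(f : M → ℝ) • FiberBundle.extend E v, ?_, ?_⟩
  · exact ContMDiffOn.smul_section_of_tsupport f.contMDiff.contMDiffOn hu hf (hX.mono hus)
  · simp

/-- The metric at a point as a bilinear form. -/
def PseudoMetric.bilin (g : PseudoMetric E M) (x : M) :
    LinearMap.BilinForm ℝ (TangentSpace 𝓘(ℝ, E) x) :=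
  LinearMap.mk₂ ℝ (fun v w ↦ g.val x v w) (by simp) (by simp) (by simp) (by simp)

omit [FiniteDimensional ℝ E] in
lemma PseudoMetric.bilin_apply (g : PseudoMetric E M) (x : M) (v w : TangentSpace 𝓘(ℝ, E) x) :
    g.bilin x v w = g.val x v w := rfl

omit [FiniteDimensional ℝ E] [IsManifold 𝓘(ℝ, E) ∞ M] in
lemma mdifferentiableAt_det {ι : Type} [Fintype ι] [DecidableEq ι] {G : M → Matrix ι ι ℝ} {x : M}
    (hG : ∀ i j, MDiffAt (fun y ↦ G y i j) x) : MDiffAt (fun y ↦ (G y).det) x := by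
  simp only [Matrix.det_apply']
  have h : MDiffAt (∑ σ : Equiv.Perm ι, fun y : M ↦ ((Equiv.Perm.sign σ : ℤ) : ℝ) *
      (∏ i, fun y : M ↦ G y (σ i) i) y) x :=
    MDifferentiableAt.sum fun (σ : Equiv.Perm ι) _ ↦
      (mdifferentiableAt_const (c := ((Equiv.Perm.sign σ : ℤ) : ℝ))).mul
        (MDifferentiableAt.prod fun i _ ↦ hG (σ i) i)
  refine h.congr_of_eventuallyEq (.of_forall fun y ↦ ?_)
  simp

-- Each entry of the adjugate is a determinant with one row replaced by a constant unit vector.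
omit [FiniteDimensional ℝ E] [IsManifold 𝓘(ℝ, E) ∞ M] in
lemma mdifferentiableAt_adjugate {ι : Type} [Fintype ι] [DecidableEq ι] {G : M → Matrix ι ι ℝ}
    {x : M} (hG : ∀ i j, MDiffAt (fun y ↦ G y i j) x) (i j : ι) :
    MDiffAt (fun y ↦ (G y).adjugate i j) x := by
  simp only [Matrix.adjugate_apply]
  refine mdifferentiableAt_det fun k l ↦ ?_
  by_cases h : k = j
  · subst h
    simpa using mdifferentiableAt_const
  · simpa [Matrix.updateRow_ne h] using hG k l

/-- Vectors with invertible Gram matrix, in number equal to the dimension, yield the expansion of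
every vector. -/
lemma PseudoMetric.eq_sum_of_det_ne_zero (g : PseudoMetric E M) {y : M}
    {v : Fin (Module.finrank ℝ E) → TangentSpace 𝓘(ℝ, E) y}
    (hv : (Matrix.of fun i j ↦ g.val y (v i) (v j)).det ≠ 0) (w : TangentSpace 𝓘(ℝ, E) y) :
    w = ∑ i, (∑ j, ((Matrix.of fun i j ↦ g.val y (v i) (v j)).det)⁻¹ *
      (Matrix.of fun i j ↦ g.val y (v i) (v j)).adjugate i j * g.val y w (v j)) • v i := by
  set G : Matrix _ _ ℝ := Matrix.of fun i j ↦ g.val y (v i) (v j) with hG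
  have hli : LinearIndependent ℝ v := by
    -- Pairing a linear relation with each `v k` gives a row vector annihilated by the invertible
    -- matrix `G`.
    rw [Fintype.linearIndependent_iff]
    intro a ha
    have : Matrix.vecMul a G = 0 := by
      ext k
      have := congrArg (fun z ↦ g.val y z (v k)) ha
      simpa [Matrix.vecMul, dotProduct, hG] using this
    exact congrFun (Matrix.eq_zero_of_vecMul_eq_zero hv this)
  have hspan : Submodule.span ℝ (Set.range v) = ⊤ :=
    hli.span_eq_top_of_card_eq_finrank' (by simp; rfl)
  refine g.ext_of_val fun z ↦ ?_
  have hz : z ∈ Submodule.span ℝ (Set.range v) := hspan ▸ Submodule.mem_top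
  induction hz using Submodule.span_induction with
  | zero => simp
  | add _ _ _ _ h1 h2 => rw [map_add, map_add, h1, h2]
  | smul c _ _ h => rw [map_smul, map_smul, h]
  | mem z hz =>
    obtain ⟨k, rfl⟩ := hz
    have hGs : G.transpose = G := by ext i j; exact g.symm y _ _
    -- Cramer's rule: this is `G * adjugate G = det G • 1` applied to the vector of products of `w`
    -- with the `v j`.
    have h : ∑ i, ∑ j, G k i * (G.adjugate i j * g.val y w (v j)) = G.det * g.val y w (v k) := by
      have h1 := congrFun (congrArg (fun A : Matrix _ _ ℝ ↦ A.mulVec fun j ↦ g.val y w (v j))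
        G.mul_adjugate) k
      simp only [← Matrix.mulVec_mulVec, Matrix.smul_mulVec, Matrix.one_mulVec] at h1
      simpa [Matrix.mulVec, dotProduct, Finset.mul_sum] using h1
    have h2 (i) : g.val y (v i) (v k) = G k i := g.symm y _ _
    simp only [map_sum, map_smul, FunLike.coe_sum, Finset.sum_apply, FunLike.coe_smul,
      Pi.smul_apply, smul_eq_mul, h2]
    rw [← mul_right_inj' hv, ← h, Finset.mul_sum]
    refine Finset.sum_congr rfl fun i _ ↦ ?_
    rw [Finset.sum_mul, Finset.mul_sum]
    refine Finset.sum_congr rfl fun j _ ↦ ?_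
    field_simp

/-- A field is differentiable as soon as its products with all smooth fields are. -/
lemma mdifferentiableAt_of_app [T2Space M] (g : PseudoMetric E M) {x : M}
    {W : ∀ x : M, TangentSpace 𝓘(ℝ, E) x}
    (hW : ∀ Z, IsSmoothField Z → MDiffAt (g.app W Z) x) : MDiffAt (T% W) x := by
  classical
  let e : Module.Basis (Fin (Module.finrank ℝ E)) ℝ (TangentSpace 𝓘(ℝ, E) x) :=
    Module.finBasis ℝ E
  choose X hX hXe using fun i ↦ exists_isSmoothField (e i)
  let G (y : M) : Matrix (Fin (Module.finrank ℝ E)) (Fin (Module.finrank ℝ E)) ℝ :=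
    Matrix.of fun i j ↦ g.app (X i) (X j) y
  have hGd (i j) : MDiffAt (fun y ↦ G y i j) x :=
    ((hX i).contMDiff_app (hX j) g).mdifferentiable (by simp) x
  have hdet : MDiffAt (fun y ↦ (G y).det) x := mdifferentiableAt_det hGd
  have hdx : (G x).det ≠ 0 := by
    have h : G x = gram (g.bilin x) e := by
      ext i j; simp [G, PseudoMetric.app, PseudoMetric.bilin_apply, hXe]
    rw [h]
    exact (isUnit_det_gram (g.symm x) (g.nondegenerate x) e).ne_zero
  have hS : MDiffAt (T% fun y ↦ ∑ i, (∑ j, ((G y).det)⁻¹ * (G y).adjugate i j *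
      g.app W (X j) y) • X i y) x := by
    refine MDifferentiableAt.sum_section fun i _ ↦ ?_
    refine MDifferentiableAt.smul_section (f := fun y ↦ ∑ j, ((G y).det)⁻¹ * (G y).adjugate i j *
      g.app W (X j) y) ?_ ((hX i).mdifferentiableAt x)
    have h : MDiffAt (∑ j, fun y ↦ ((G y).det)⁻¹ * (G y).adjugate i j * g.app W (X j) y) x :=
      MDifferentiableAt.sum fun j _ ↦
        ((hdet.inv hdx).mul (mdifferentiableAt_adjugate hGd i j)).mul (hW _ (hX j))
    refine h.congr_of_eventuallyEq (.of_forall fun y ↦ ?_)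
    simp
  refine hS.congr_of_eventuallyEq ?_
  -- The fields `X i` remain a frame where the Gram determinant is nonzero, hence near `x`; there
  -- `W` equals its expansion, whose coefficients are differentiable at `x`.
  filter_upwards [hdet.continuousAt.eventually_ne hdx] with y hy
  exact congrArg _ (g.eq_sum_of_det_ne_zero hy (W y))

/-- The covariant derivative of a smooth field along a smooth field is differentiable. -/
lemma mdifferentiableAt_leviCivita [T2Space M] (g : PseudoMetric E M)
    {X Y : ∀ x : M, TangentSpace 𝓘(ℝ, E) x} (hX : IsSmoothField X) (hY : IsSmoothField Y) (x : M) :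
    MDiffAt (T% fun y ↦ leviCivita g Y y (X y)) x := by
  refine mdifferentiableAt_of_app g fun Z hZ ↦ ?_
  have h : MDiffAt (fun y ↦ (2⁻¹ : ℝ) * koszul g X Y Z y) x :=
    mdifferentiableAt_const.mul (mdifferentiableAt_koszul g hX hY hZ x)
  refine h.congr_of_eventuallyEq (.of_forall fun y ↦ ?_)
  exact val_leviCivitaFun g (hX.mdifferentiableAt y) (hY.mdifferentiableAt y)
    (hZ.mdifferentiableAt y)

end SmoothFields

/-! ### The second covariant derivative of `J` and its symmetries. -/

section SecondDerivative

variable {E : Type*} [NormedAddCommGroup E] [NormedSpace ℝ E]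
  {M : Type*} [TopologicalSpace M] [ChartedSpace E M] [IsManifold 𝓘(ℝ, E) ∞ M]

omit [IsManifold 𝓘(ℝ, E) ∞ M] in
lemma mvfderiv_add_add_eq_zero {f₁ f₂ f₃ : M → ℝ} {x : M} (h₁ : MDiffAt f₁ x) (h₂ : MDiffAt f₂ x)
    (h₃ : MDiffAt f₃ x) (h : f₁ + f₂ + f₃ = 0) (v : TangentSpace 𝓘(ℝ, E) x) :
    d% f₁ x v + d% f₂ x v + d% f₃ x v = 0 := by
  have := congrArg (fun f : M → ℝ ↦ d% f x v) h
  simpa [mvfderiv_add (h₁.add h₂) h₃, mvfderiv_add h₁ h₂] using this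

variable [FiniteDimensional ℝ E]

lemma leviCivita_add (g : PseudoMetric E M) {Y Y' : ∀ x : M, TangentSpace 𝓘(ℝ, E) x} {x : M}
    (hY : MDiffAt (T% Y) x) (hY' : MDiffAt (T% Y') x) :
    leviCivita g (Y + Y') x = leviCivita g Y x + leviCivita g Y' x :=
  (leviCivita g).isCovariantDerivativeOnUniv.add hY hY'

lemma leviCivita_neg (g : PseudoMetric E M) {Y : ∀ x : M, TangentSpace 𝓘(ℝ, E) x} {x : M}
    (hY : MDiffAt (T% Y) x) : leviCivita g (-Y) x = -leviCivita g Y x := by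
  have h := (leviCivita g).isCovariantDerivativeOnUniv.leibniz hY
    (mdifferentiableAt_const (c := (-1 : ℝ)))
  have e : (fun _ : M ↦ (-1 : ℝ)) • Y = -Y := by ext y; simp
  rw [e] at h
  rw [h]; ext v; simp [mvfderiv_const]

/-- The endomorphism `v ↦ (∇_u J) v` of `T_x M`. -/
def nablaJEnd (g : PseudoMetric E M) (J : AlmostComplexStructure E M) (x : M)
    (u : TangentSpace 𝓘(ℝ, E) x) : Module.End ℝ (TangentSpace 𝓘(ℝ, E) x) where
  toFun v := nablaJ g J x u v
  map_add' v w := by simp [nablaJ]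
  map_smul' c v := by simp [nablaJ]

lemma nablaJ_sub_left (g : PseudoMetric E M) (J : AlmostComplexStructure E M) (x : M)
    (u u' v : TangentSpace 𝓘(ℝ, E) x) :
    nablaJ g J x (u - u') v = nablaJ g J x u v - nablaJ g J x u' v := by simp [nablaJ]

lemma nablaJ_add_right (g : PseudoMetric E M) (J : AlmostComplexStructure E M) (x : M)
    (u v v' : TangentSpace 𝓘(ℝ, E) x) :
    nablaJ g J x u (v + v') = nablaJ g J x u v + nablaJ g J x u v' := by simp [nablaJ]

/-- `(∇_u J) ∘ J = -J ∘ (∇_u J)`. -/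
lemma nablaJ_anticomm (g : PseudoMetric E M) (J : AlmostComplexStructure E M) (x : M)
    (u v : TangentSpace 𝓘(ℝ, E) x) :
    nablaJ g J x u (J.val x v) = -J.val x (nablaJ g J x u v) := by
  obtain ⟨V, hV, rfl⟩ : ∃ V : ∀ x : M, TangentSpace 𝓘(ℝ, E) x, MDiffAt (T% V) x ∧ V x = v :=
    ⟨FiberBundle.extend E v, FiberBundle.mdifferentiableAt_extend .., by simp⟩
  have e : J.app (J.app V) = -V := by ext y; exact J.sq y _
  change nablaJ g J x u (J.app V x) = _
  rw [nablaJ_apply g J u (J.mdifferentiableAt_app hV), nablaJ_apply g J u hV, e,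
    leviCivita_neg g hV, map_sub, J.sq]
  simp only [neg_apply]
  abel

omit [FiniteDimensional ℝ E] in
lemma IsNorden.symm {g : PseudoMetric E M} {J : AlmostComplexStructure E M} (h : IsNorden g J)
    {x : M} (v w : TangentSpace 𝓘(ℝ, E) x) : g.val x (J.val x v) w = g.val x v (J.val x w) := by
  have := h x (J.val x v) w
  rw [J.sq, map_neg, neg_apply] at this
  linarith

/-- `∇_u J` is self-adjoint. -/
lemma IsNorden.nablaJ_symm {g : PseudoMetric E M} {J : AlmostComplexStructure E M}
    (h : IsNorden g J) {x : M} (u v w : TangentSpace 𝓘(ℝ, E) x) :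
    g.val x (nablaJ g J x u v) w = g.val x v (nablaJ g J x u w) := by
  have hext (v : TangentSpace 𝓘(ℝ, E) x) :
      ∃ V : ∀ x : M, TangentSpace 𝓘(ℝ, E) x, MDiffAt (T% V) x ∧ V x = v :=
    ⟨FiberBundle.extend E v, FiberBundle.mdifferentiableAt_extend .., by simp⟩
  obtain ⟨U, hU, rfl⟩ := hext u
  obtain ⟨V, hV, rfl⟩ := hext v
  obtain ⟨W, hW, rfl⟩ := hext w
  -- Self-adjointness of `J` is an identity between functions; differentiating both sides along `U`
  -- with the metric property gives that of `∇_U J`.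
  have e : g.app (J.app V) W = g.app V (J.app W) := by ext y; exact h.symm _ _
  have h1 := leviCivita_metric g hU (J.mdifferentiableAt_app hV) hW
  have h2 := leviCivita_metric g hU hV (J.mdifferentiableAt_app hW)
  rw [e, h2] at h1
  rw [nablaJ_apply g J _ hV, nablaJ_apply g J _ hW, map_sub, map_sub, sub_apply, h.symm,
    ← h.symm (V x)]
  simp only [AlmostComplexStructure.app] at h1 ⊢
  linarith

/-- The field `(∇_Y J) Z`. -/
def nablaJField (g : PseudoMetric E M) (J : AlmostComplexStructure E M)
    (Y Z : ∀ x : M, TangentSpace 𝓘(ℝ, E) x) : ∀ x : M, TangentSpace 𝓘(ℝ, E) x :=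
  fun y ↦ nablaJ g J y (Y y) (Z y)

/-- The second covariant derivative `(∇²_{X,Y} J) Z`. -/
def hessJ (g : PseudoMetric E M) (J : AlmostComplexStructure E M)
    (X Y Z : ∀ x : M, TangentSpace 𝓘(ℝ, E) x) (x : M) : TangentSpace 𝓘(ℝ, E) x :=
  leviCivita g (nablaJField g J Y Z) x (X x) - nablaJ g J x (leviCivita g Y x (X x)) (Z x)
    - nablaJ g J x (Y x) (leviCivita g Z x (X x))

variable {g : PseudoMetric E M} {J : AlmostComplexStructure E M}
  {X Y Z U : ∀ x : M, TangentSpace 𝓘(ℝ, E) x}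

lemma nablaJField_eq (Y : ∀ x : M, TangentSpace 𝓘(ℝ, E) x) (hZ : IsSmoothField Z) :
    nablaJField g J Y Z = (fun y ↦ leviCivita g (J.app Z) y (Y y)) +
      -(J.app fun y ↦ leviCivita g Z y (Y y)) := by
  ext y
  simp [nablaJField, nablaJ_apply g J (Y y) (hZ.mdifferentiableAt y), AlmostComplexStructure.app,
    sub_eq_add_neg]

lemma mdifferentiableAt_nablaJField [T2Space M] (hY : IsSmoothField Y) (hZ : IsSmoothField Z)
    (x : M) : MDiffAt (T% (nablaJField g J Y Z)) x := by
  rw [nablaJField_eq Y hZ]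
  exact mdifferentiableAt_add_section (mdifferentiableAt_leviCivita g hY (hZ.app J) x)
    (mdifferentiableAt_neg_section
      (J.mdifferentiableAt_app (mdifferentiableAt_leviCivita g hY hZ x)))

/-- The covariant derivative of `F`, in terms of the second covariant derivative of `J`. -/
lemma val_hessJ [T2Space M] {x : M} (hX : IsSmoothField X) (hY : IsSmoothField Y)
    (hZ : IsSmoothField Z) (hU : IsSmoothField U) :
    g.val x (hessJ g J X Y Z x) (U x) = d% (g.app (nablaJField g J Y Z) U) x (X x)
      - tensorF g J x (leviCivita g Y x (X x)) (Z x) (U x)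
      - tensorF g J x (Y x) (leviCivita g Z x (X x)) (U x)
      - tensorF g J x (Y x) (Z x) (leviCivita g U x (X x)) := by
  rw [leviCivita_metric g (hX.mdifferentiableAt x) (mdifferentiableAt_nablaJField hY hZ x)
    (hU.mdifferentiableAt x)]
  simp only [hessJ, map_sub, sub_apply, tensorF, nablaJField]
  ring

lemma IsNorden.val_hessJ_symm [T2Space M] (h : IsNorden g J) {x : M} (hX : IsSmoothField X)
    (hY : IsSmoothField Y) (hZ : IsSmoothField Z) (hU : IsSmoothField U) :
    g.val x (hessJ g J X Y Z x) (U x) = g.val x (hessJ g J X Y U x) (Z x) := by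
  have hF (y : M) (u v w : TangentSpace 𝓘(ℝ, E) y) : tensorF g J y u v w = tensorF g J y u w v := by
    rw [tensorF, tensorF, h.nablaJ_symm, g.symm]
  have e : g.app (nablaJField g J Y Z) U = g.app (nablaJField g J Y U) Z := by
    ext y; exact hF ..
  rw [val_hessJ hX hY hZ hU, val_hessJ hX hY hU hZ, e, hF x _ (Z x) (U x),
    hF x _ (leviCivita g Z x (X x)), hF x _ (Z x) (leviCivita g U x (X x))]
  ring

/-- The cyclic sum of `F` vanishes identically, hence so does its derivative along `X`. The nine
correction terms in `val_hessJ` group into three further cyclic sums of `F`, each zero. -/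
lemma IsW₃.val_hessJ_cyclic [T2Space M] (h : IsW₃ g J) {x : M} (hX : IsSmoothField X)
    (hY : IsSmoothField Y) (hZ : IsSmoothField Z) (hU : IsSmoothField U) :
    g.val x (hessJ g J X Y Z x) (U x) + g.val x (hessJ g J X Z U x) (Y x)
      + g.val x (hessJ g J X U Y x) (Z x) = 0 := by
  have hd {Y Z U : ∀ x : M, TangentSpace 𝓘(ℝ, E) x} (hY : IsSmoothField Y) (hZ : IsSmoothField Z)
      (hU : IsSmoothField U) : MDiffAt (g.app (nablaJField g J Y Z) U) x :=
    g.mdifferentiableAt_app (mdifferentiableAt_nablaJField hY hZ x) (hU.mdifferentiableAt x)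
  have e : g.app (nablaJField g J Y Z) U + g.app (nablaJField g J Z U) Y
      + g.app (nablaJField g J U Y) Z = 0 := by
    ext y; exact h.2 y (Y y) (Z y) (U y)
  have hsum := mvfderiv_add_add_eq_zero (hd hY hZ hU) (hd hZ hU hY) (hd hU hY hZ) e (X x)
  rw [val_hessJ hX hY hZ hU, val_hessJ hX hZ hU hY, val_hessJ hX hU hY hZ]
  linarith [h.2 x (leviCivita g Y x (X x)) (Z x) (U x), h.2 x (Y x) (leviCivita g Z x (X x)) (U x),
    h.2 x (Y x) (Z x) (leviCivita g U x (X x))]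

/-- Differentiating `J² = -1` twice. -/
lemma hessJ_app [T2Space M] {x : M} (hY : IsSmoothField Y) (hZ : IsSmoothField Z) :
    hessJ g J X Y (J.app Z) x + J.val x (hessJ g J X Y Z x)
      = -(nablaJ g J x (X x) (nablaJ g J x (Y x) (Z x))
        + nablaJ g J x (Y x) (nablaJ g J x (X x) (Z x))) := by
  have hA := mdifferentiableAt_nablaJField (g := g) (J := J) hY hZ x
  -- The first derivative of `J² = -1` is this anticommutation; the second comes from
  -- differentiating it along `X`.
  have e : nablaJField g J Y (J.app Z) = -J.app (nablaJField g J Y Z) := by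
    ext y; exact nablaJ_anticomm g J y (Y y) (Z y)
  have h1 := nablaJ_apply g J (X x) hA
  have h2 := nablaJ_apply g J (X x) (hZ.mdifferentiableAt x)
  have h3 : leviCivita g (J.app Z) x (X x)
      = nablaJ g J x (X x) (Z x) + J.val x (leviCivita g Z x (X x)) := by rw [h2]; abel
  have h4 : leviCivita g (J.app (nablaJField g J Y Z)) x (X x)
      = nablaJ g J x (X x) (nablaJ g J x (Y x) (Z x))
        + J.val x (leviCivita g (nablaJField g J Y Z) x (X x)) := by
    rw [sub_eq_iff_eq_add.1 h1.symm]; rfl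
  simp only [hessJ, e, leviCivita_neg g (J.mdifferentiableAt_app hA), neg_apply, h3, h4,
    nablaJ_add_right, nablaJ_anticomm, map_sub]
  rw [show J.app Z x = J.val x (Z x) from rfl, nablaJ_anticomm]
  abel

/-- The Ricci identity for `J`. -/
lemma hessJ_sub_hessJ [T2Space M] {x : M} (hX : IsSmoothField X) (hY : IsSmoothField Y)
    (hZ : IsSmoothField Z) :
    hessJ g J X Y Z x - hessJ g J Y X Z x
      = curvature g X Y (J.app Z) x - J.val x (curvature g X Y Z x) := by
  have key {X Y : ∀ x : M, TangentSpace 𝓘(ℝ, E) x} (hY : IsSmoothField Y) :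
      leviCivita g (nablaJField g J Y Z) x (X x)
        = leviCivita g (fun y ↦ leviCivita g (J.app Z) y (Y y)) x (X x)
          - nablaJ g J x (X x) (leviCivita g Z x (Y x))
          - J.val x (leviCivita g (fun y ↦ leviCivita g Z y (Y y)) x (X x)) := by
    have hD := mdifferentiableAt_leviCivita g hY hZ x
    rw [nablaJField_eq Y hZ, leviCivita_add g (mdifferentiableAt_leviCivita g hY (hZ.app J) x)
      (mdifferentiableAt_neg_section (J.mdifferentiableAt_app hD)),
      leviCivita_neg g (J.mdifferentiableAt_app hD), nablaJ_apply g J (X x) hD]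
    simp only [add_apply, neg_apply]
    abel
  have htor : VectorField.mlieBracket 𝓘(ℝ, E) X Y x
      = leviCivita g Y x (X x) - leviCivita g X x (Y x) :=
    ((CovariantDerivative.torsion_eq_zero_iff _).1 (leviCivita_torsion g)
      (hX.mdifferentiableAt x) (hY.mdifferentiableAt x)).symm
  have hbr := nablaJ_apply g J (VectorField.mlieBracket 𝓘(ℝ, E) X Y x) (hZ.mdifferentiableAt x)
  rw [htor, nablaJ_sub_left, ← htor] at hbr
  -- The terms `(∇_X J)(∇_Y Z)` and `(∇_Y J)(∇_X Z)` enter symmetrically and cancel; by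
  -- torsion-freeness the rest of the correction is `(∇_[X,Y] J) Z`, which supplies the bracket
  -- terms of both curvatures.
  simp only [hessJ, key hX, key hY, curvature, map_sub]
  rw [← sub_eq_zero] at hbr ⊢
  rw [← neg_eq_zero, ← hbr]
  abel

/-- On a Norden manifold with Kähler curvature tensor, the second covariant derivative of `J` is
symmetric. -/
lemma HasKahlerCurvature.hessJ_comm [T2Space M] (hN : IsNorden g J) (hR : HasKahlerCurvature g J)
    {x : M} (hX : IsSmoothField X) (hY : IsSmoothField Y) (hZ : IsSmoothField Z) :
    hessJ g J X Y Z x = hessJ g J Y X Z x := by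
  rw [← sub_eq_zero, hessJ_sub_hessJ hX hY hZ, sub_eq_zero]
  -- Moving `J` across `g` turns the Kähler condition into `J R(X,Y) J Z = -R(X,Y) Z`; one more `J`
  -- makes this say that `R(X,Y)` commutes with `J`.
  have hJJ : J.val x (J.val x (curvature g X Y (J.app Z) x))
      = J.val x (J.val x (J.val x (curvature g X Y Z x))) := by
    congr 1
    rw [J.sq]
    refine g.ext_of_val fun u ↦ ?_
    obtain ⟨U, hU, rfl⟩ := exists_isSmoothField u
    have h := hR X Y Z U hX hY hZ hU x
    rw [hN.symm, map_neg, neg_apply]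
    exact h
  simpa only [J.sq, map_neg, neg_inj] using hJJ

end SecondDerivative

/-! ### From the geometry at a point to the algebraic core. -/

section Main

variable {E : Type*} [NormedAddCommGroup E] [NormedSpace ℝ E] [FiniteDimensional ℝ E]
  {M : Type*} [TopologicalSpace M] [T2Space M] [ChartedSpace E M] [IsManifold 𝓘(ℝ, E) ∞ M]

theorem IsW₃.isIsotropicKahler {g : PseudoMetric E M} {J : AlmostComplexStructure E M}
    (hW : IsW₃ g J) (hR : HasKahlerCurvature g J) : IsIsotropicKahler g J := by
  intro x e
  choose X hX hXe using fun i ↦ exists_isSmoothField (e i)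
  let Jx : Module.End ℝ (TangentSpace 𝓘(ℝ, E) x) := (J.val x).toLinearMap
  let A (i : Fin (Module.finrank ℝ E)) := nablaJEnd g J x (e i)
  let b (i j : Fin (Module.finrank ℝ E)) : Module.End ℝ (TangentSpace 𝓘(ℝ, E) x) :=
    e.constr ℝ fun k ↦ hessJ g J (X i) (X j) (X k) x
  have hbe (i j k) : b i j (e k) = hessJ g J (X i) (X j) (X k) x := e.constr_basis ..
  have hb₂ (i j k l) : g.bilin x (b i j (e k)) (e l) = g.bilin x (b i j (e l)) (e k) := by
    simp only [hbe, PseudoMetric.bilin_apply]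
    simpa only [hXe] using hW.1.val_hessJ_symm (x := x) (hX i) (hX j) (hX k) (hX l)
  have hbs (i j k) (v) : g.bilin x (b i j v) (e k) = g.bilin x (b i j (e k)) v := by
    have h : (g.bilin x).flip (e k) ∘ₗ b i j = g.bilin x (b i j (e k)) :=
      e.ext fun l ↦ hb₂ i j l k
    exact LinearMap.congr_fun h v
  -- Since `b i j` is prescribed only on the chosen fields, tensoriality in `Z` has to be shown. It
  -- follows from self-adjointness: paired with `X k`, the second derivative on `Z` becomes the one
  -- on `X k` paired with `Z`, which sees only `Z x`. This is needed for `Z = J X_k`.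
  have hbZ (i j) {Z : ∀ x : M, TangentSpace 𝓘(ℝ, E) x} (hZ : IsSmoothField Z) :
      b i j (Z x) = hessJ g J (X i) (X j) Z x := by
    refine g.ext_of_val fun z ↦ ?_
    have h : g.bilin x (b i j (Z x)) = g.bilin x (hessJ g J (X i) (X j) Z x) := by
      refine e.ext fun k ↦ ?_
      rw [hbs, hbe, PseudoMetric.bilin_apply, PseudoMetric.bilin_apply, ← hXe k]
      exact (hW.1.val_hessJ_symm (hX i) (hX j) hZ (hX k)).symm
    exact LinearMap.congr_fun h z
  refine sum_inv_gram_mul_inv_gram_eq_zero (B := g.bilin x) (J := Jx) (A := A) (b := b)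
    (g.symm x) (g.nondegenerate x) e (LinearMap.ext fun v ↦ J.sq x v)
    (fun v w ↦ hW.1.symm v w) (fun i v w ↦ hW.1.nablaJ_symm (e i) v w)
    (fun i ↦ LinearMap.ext fun v ↦ nablaJ_anticomm g J x (e i) v) (fun i j ↦ e.ext fun k ↦ ?_)
    (fun i j k l ↦ ?_) hb₂ (fun i j k l ↦ ?_)
  · have h := hessJ_app (g := g) (J := J) (X := X i) (x := x) (hX j) (hX k)
    rw [← hbZ i j ((hX k).app J), ← hbZ i j (hX k)] at h
    simp only [AlmostComplexStructure.app, hXe] at h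
    exact h
  · rw [hbe, hbe, hR.hessJ_comm hW.1 (hX i) (hX j) (hX k)]
  · simp only [hbe, PseudoMetric.bilin_apply]
    simpa only [hXe] using hW.val_hessJ_cyclic (x := x) (hX i) (hX j) (hX k) (hX l)

end Main

end NordenGeometry

end

theorem mainTheorem3
    {E : Type*} [NormedAddCommGroup E] [NormedSpace ℝ E] [FiniteDimensional ℝ E]
    {M : Type*} [TopologicalSpace M] [T2Space M] [SecondCountableTopology M] [ChartedSpace E M]
    [IsManifold 𝓘(ℝ, E) ∞ M]
    (hdim : 4 ≤ Module.finrank ℝ E)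
    (g : NordenGeometry.PseudoMetric E M) (J : NordenGeometry.AlmostComplexStructure E M)
    (hW₃ : NordenGeometry.IsW₃ g J) (hR : NordenGeometry.HasKahlerCurvature g J) :
    NordenGeometry.IsIsotropicKahler g J :=
  hW₃.isIsotropicKahler hR
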